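/- Let $A$ be a finite set, let $F=F(A)$ be the free group on $A$, put $\Sigma=A\cup A^{-1}$, and let $H\le F$ be a subgroup. Let $L_H\subseteq\Sigma^*$ be the language of all freely reduced words that represent elements of $H$. The subgroup $H$ is called conjugacy reduced if there are two nonempty words in $L_H$ with different last letters. For a language $L\subseteq\Sigma^*$, let $B_n(L)$ be the set of words of length $n$ in $L$; the entropy of $L$ is $$h(L)=\limsup_{n\to\infty}\frac{\log|B_n(L)|}{n}\qquad(\text{with }\log 0=-\infty).$$ The extended Schreier graph of $H$ is the directed labelled graph whose vertices are the right cosets $Hg$, $g\in F$, with one edge labelled $x$ from $v=Hg$ to $v\cdot x=Hgx$ for each vertex $v$ and each $x\in\Sigma$; its root is $v_0=H$. Let $\widehat E$ be the set of those of its edges that are traversed by some path from $v_0$ to $v_0$ whose label is a freely reduced word (the edges of the extended core of $H$). The automaton $\widehat{\mathcal D}_H$ over the alphabet $\Sigma$ is defined as follows. Its states are the pairs $(v,x)$ such that some edge in $\widehat E$ has terminus $v$ and label $x\in\Sigma$; from the state $(v,x)$ there is a transition labelled $y$ to $(v\cdot y,y)$ for each $y\in\Sigma$ with $y\ne x^{-1}$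 such that the edge labelled $y$ with origin $v$ lies in $\widehat E$; the initial states, which are also the final states, are the states of the form $(v_0,x)$. Its adjacency matrix $M_{\widehat{\mathcal D}_H}$ is the square matrix, indexed by the states, whose $(q,q')$ entry is the number of transitions from $q$ to $q'$. Theorem. Let $H$ be finitely generated, conjugacy reduced and not cyclic. Then $\widehat{\mathcal D}_H$ has finitely many states, the matrix $M_{\widehat{\mathcal D}_H}$ has a maximal (Perron) eigenvalue, i.e. a real eigenvalue $\lambda>0$ such that $|\mu|\le\lambda$ for every complex eigenvalue $\mu$ of $M_{\widehat{\mathcal D}_H}$, and $$h(L_H)=\log\lambda .$$ -/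

import Mathlib

namespace CogrowthEntropy

/-- The entropy `limsup_{n → ∞} log |B_n(L)| / n` of a formal language, `B_n(L)` being the set of
words of length `n` in `L`. It lives in the extended reals, with `log 0 = -∞`, so that the `limsup`
makes sense for every language, also when some `B_n(L)` are empty. -/
noncomputable def entropy {S : Type*} (L : Language S) : EReal :=
  Filter.limsup
    (fun n : ℕ => ENNReal.log (({w : List S | w ∈ L ∧ w.length = n}.encard : ENat) : ENNReal)
      / ((n : ℝ) : EReal))
    Filter.atTop

/-- The adjacency matrix of (the Moore diagram of) an automaton: the entry at `(q, q')` is the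
number of edges from `q` to `q'`, that is, of letters `s` with `q' ∈ δ(q, s)`. -/
noncomputable def adjacencyMatrix {S Q : Type*} (M : NFA S Q) : Matrix Q Q ℕ :=
  Matrix.of fun q q' => {s : S | q' ∈ M.step q s}.ncard

section FreeGroup

variable {A : Type*}

/-- The inverse letter in the alphabet `A ∪ A⁻¹`, which is modelled by `A × Bool` as in Mathlib's
`FreeGroup` (`(a, true)` is `a` and `(a, false)` is `a⁻¹`). -/
def invLetter (x : A × Bool) : A × Bool := (x.1, !x.2)

/-- The language `L_H` of all freely reduced words over `A ∪ A⁻¹` that represent elements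
of `H`. -/
def reducedLanguage (H : Subgroup (FreeGroup A)) : Language (A × Bool) :=
  {w | FreeGroup.IsReduced w ∧ FreeGroup.mk w ∈ H}

/-- `H` is conjugacy reduced: two nonempty words of `L_H` have different last letters. -/
def ConjugacyReduced (H : Subgroup (FreeGroup A)) : Prop :=
  ∃ (u v : List (A × Bool)) (x y : A × Bool),
    u ++ [x] ∈ reducedLanguage H ∧ v ++ [y] ∈ reducedLanguage H ∧ x ≠ y

/-- The vertices of the Schreier graph: the right cosets `H g`. -/
abbrev SchreierVertex (H : Subgroup (FreeGroup A)) : Type _ :=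
  Quotient (QuotientGroup.rightRel H)

/-- The root `v₀ = H` of the Schreier graph. -/
def root (H : Subgroup (FreeGroup A)) : SchreierVertex H :=
  Quotient.mk (QuotientGroup.rightRel H) 1

/-- The vertex `v · w` at which the path with label `w` in the extended Schreier graph ends, if it
starts at the vertex `v`: if `v = H g`, then `v · w = H g w`. For a one-letter word this is the
terminus of the unique edge with that label and origin `v`. -/
def endpoint (H : Subgroup (FreeGroup A)) (v : SchreierVertex H) (w : List (A × Bool)) :
    SchreierVertex H :=
  Quotient.map' (fun g => g * FreeGroup.mk w)
    (fun g g' h => by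
      rw [QuotientGroup.rightRel_apply] at h ⊢
      rwa [mul_inv_rev, mul_assoc, mul_inv_cancel_left]) v

/-- The edges of the extended core. An edge of the extended Schreier graph is given by its origin
`v` and its label `x`; it belongs to the extended core if it is traversed by a closed reduced path
that starts and ends at the root. (A path from the root is determined by its label; traversing it
backwards shows that the set is closed under inversion of edges.) -/
def extendedCoreEdges (H : Subgroup (FreeGroup A)) : Set (SchreierVertex H × (A × Bool)) :=
  {e | ∃ w₁ w₂ : List (A × Bool),
    FreeGroup.IsReduced (w₁ ++ e.2 :: w₂) ∧
    endpoint H (root H) (w₁ ++ e.2 :: w₂) = root H ∧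
    endpoint H (root H) w₁ = e.1}

/-- The states of the automaton `D̂_H`: the pairs `(v, x)` such that some edge of the extended core
has terminus `v` and label `x`. -/
abbrev DHatState (H : Subgroup (FreeGroup A)) : Type _ :=
  {q : SchreierVertex H × (A × Bool) //
    ∃ e ∈ extendedCoreEdges H, endpoint H e.1 [e.2] = q.1 ∧ e.2 = q.2}

/-- The automaton `D̂_H`: there is a transition `(v, x) → (v · y, y)` with label `y` for every edge
of the extended core with origin `v` and label `y ≠ x⁻¹`; the initial states are the states
`(v₀, x)`, and they are also the final states. -/
def DHat (H : Subgroup (FreeGroup A)) : NFA (A × Bool) (DHatState H) where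
  step q y := {q' | y ≠ invLetter q.1.2 ∧ (q.1.1, y) ∈ extendedCoreEdges H ∧
    q'.1 = (endpoint H q.1.1 [y], y)}
  start := {q | q.1.1 = root H}
  accept := {q | q.1.1 = root H}

end FreeGroup

end CogrowthEntropy

namespace CogrowthEntropy

section Perron

open Matrix

variable {n : Type*} [Fintype n]

theorem mulVec_pos_of_pos {P : Matrix n n ℝ} (hP : ∀ i j, 0 < P i j) {z : n → ℝ}
    (hz : ∀ i, 0 ≤ z i) (hz0 : z ≠ 0) (i : n) : 0 < (P *ᵥ z) i := by
  obtain ⟨j, hj⟩ := Function.ne_iff.1 hz0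
  exact Finset.sum_pos' (fun j _ => mul_nonneg (hP i j).le (hz j))
    ⟨j, Finset.mem_univ j, mul_pos (hP i j) ((hz j).lt_of_ne' hj)⟩

/-- The maximal value of the Collatz–Wielandt function is attained. -/
theorem exists_max_collatzWielandt [Nonempty n] {B : Matrix n n ℝ} (hB : ∀ i j, 0 ≤ B i j) :
    ∃ x ∈ stdSimplex ℝ n, ∃ l : ℝ, 0 ≤ l ∧ (∀ i, l * x i ≤ (B *ᵥ x) i) ∧
      ∀ y ∈ stdSimplex ℝ n, ∀ m : ℝ, 0 ≤ m → (∀ i, m * y i ≤ (B *ᵥ y) i) → m ≤ l := by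
  set C : ℝ := ∑ i, ∑ j, B i j with hC
  have hbound : ∀ y ∈ stdSimplex ℝ n, ∀ m : ℝ, (∀ i, m * y i ≤ (B *ᵥ y) i) → m ≤ C := by
    intro y hy m hm
    calc m = ∑ i, m * y i := by rw [← Finset.mul_sum, hy.2, mul_one]
      _ ≤ ∑ i, (B *ᵥ y) i := Finset.sum_le_sum fun i _ => hm i
      _ ≤ C := by
        refine Finset.sum_le_sum fun i _ => Finset.sum_le_sum fun j _ => ?_
        have : y j ≤ 1 := by
          rw [← hy.2]
          exact Finset.single_le_sum (f := y) (fun i _ => hy.1 i) (Finset.mem_univ j)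
        exact mul_le_of_le_one_right (hB i j) this
  let K : Set ((n → ℝ) × ℝ) :=
    (stdSimplex ℝ n ×ˢ Set.Icc 0 C) ∩ {p | ∀ i, p.2 * p.1 i ≤ (B *ᵥ p.1) i}
  have hcl : IsClosed {p : (n → ℝ) × ℝ | ∀ i, p.2 * p.1 i ≤ (B *ᵥ p.1) i} := by
    simp only [Set.ofPred_forall]
    refine isClosed_iInter fun i => isClosed_le (by fun_prop) ?_
    simp only [Matrix.mulVec, dotProduct]
    fun_prop
  have hK : IsCompact K := ((isCompact_stdSimplex ℝ n).prod isCompact_Icc).inter_right hcl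
  have hne : K.Nonempty := by
    classical
    obtain ⟨i⟩ := ‹Nonempty n›
    have hs := single_mem_stdSimplex ℝ i
    refine ⟨(Pi.single i 1, 0), ⟨hs, le_rfl, ?_⟩, fun j => ?_⟩
    · exact Finset.sum_nonneg fun i _ => Finset.sum_nonneg fun j _ => hB i j
    · simp only [zero_mul]
      exact Finset.sum_nonneg fun k _ => mul_nonneg (hB j k) (hs.1 k)
  obtain ⟨⟨x, l⟩, ⟨⟨hx, hl⟩, hxl⟩, hmax⟩ := hK.exists_isMaxOn hne continuous_snd.continuousOn
  refine ⟨x, hx, l, hl.1, hxl, fun y hy m hm hym => ?_⟩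
  have hmem : (y, m) ∈ K := by
    refine ⟨⟨hy, hm, hbound y hy m hym⟩, ?_⟩
    rw [Set.mem_ofPred_eq]
    exact hym
  exact hmax hmem

theorem norm_le_of_pos_eigenvector {B : Matrix n n ℝ} (hB : ∀ i j, 0 ≤ B i j) {v : n → ℝ} {l : ℝ}
    (hv : ∀ i, 0 < v i) (h : B *ᵥ v = l • v) {w : n → ℂ} (hw : w ≠ 0) {μ : ℂ}
    (hμ : (B.map fun x => (x : ℂ)) *ᵥ w = μ • w) : ‖μ‖ ≤ l := by
  obtain ⟨j, hj⟩ := Function.ne_iff.1 hw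
  obtain ⟨i, -, hi⟩ := Finset.exists_max_image Finset.univ (fun i => ‖w i‖ / v i) ⟨j, Finset.mem_univ j⟩
  set t := ‖w i‖ / v i with ht
  have hwt : ∀ k, ‖w k‖ ≤ t * v k := fun k => (div_le_iff₀ (hv k)).1 (hi k (Finset.mem_univ k))
  have hwi : ‖w i‖ = t * v i := by rw [ht, div_mul_cancel₀ _ (hv i).ne']
  have htpos : 0 < t := (div_pos (norm_pos_iff.2 hj) (hv j)).trans_le (hi j (Finset.mem_univ j))
  have h1 : ‖μ‖ * (t * v i) ≤ l * (t * v i) := calc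
    ‖μ‖ * (t * v i) = ‖(μ • w) i‖ := by rw [Pi.smul_apply, norm_smul, hwi]
    _ = ‖∑ k, (B i k : ℂ) * w k‖ := by rw [← hμ]; rfl
    _ ≤ ∑ k, ‖(B i k : ℂ) * w k‖ := norm_sum_le _ _
    _ ≤ ∑ k, t * (B i k * v k) := by
      refine Finset.sum_le_sum fun k _ => ?_
      rw [norm_mul, Complex.norm_real, Real.norm_of_nonneg (hB i k), mul_left_comm]
      exact mul_le_mul_of_nonneg_left (hwt k) (hB i k)
    _ = t * (B *ᵥ v) i := by rw [← Finset.mul_sum]; rfl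
    _ = l * (t * v i) := by rw [h, Pi.smul_apply, smul_eq_mul, mul_left_comm]
  exact le_of_mul_le_mul_right h1 (mul_pos htpos (hv i))

variable [DecidableEq n]

theorem mulVec_pow_eq_smul {R : Type*} [CommSemiring R] {B : Matrix n n R} {v : n → R} {l : R}
    (h : B *ᵥ v = l • v) (k : ℕ) : (B ^ k) *ᵥ v = l ^ k • v := by
  induction k with
  | zero => simp
  | succ k ih => rw [pow_succ, ← mulVec_mulVec, h, mulVec_smul, ih, smul_smul, pow_succ']

theorem pow_apply_nonneg {B : Matrix n n ℝ} (hB : ∀ i j, 0 ≤ B i j) (k : ℕ) (i j : n) :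
    0 ≤ (B ^ k) i j := by
  induction k generalizing i j with
  | zero => rw [pow_zero, Matrix.one_apply]; split_ifs <;> simp
  | succ k ih =>
    rw [pow_succ, Matrix.mul_apply]
    exact Finset.sum_nonneg fun m _ => mul_nonneg (ih i m) (hB m j)

/-- Some polynomial with nonnegative coefficients in an irreducible matrix is entrywise positive. -/
theorem exists_sum_pow_pos {B : Matrix n n ℝ} (hB : ∀ i j, 0 ≤ B i j)
    (hirr : ∀ i j, ∃ k, 0 < (B ^ k) i j) :
    ∃ N : ℕ, ∀ i j, 0 < (∑ k ∈ Finset.range N, B ^ k) i j := by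
  choose K hK using hirr
  refine ⟨(Finset.univ.sup fun i => Finset.univ.sup fun j => K i j) + 1, fun i j => ?_⟩
  rw [Matrix.sum_apply]
  refine Finset.sum_pos' (fun k _ => pow_apply_nonneg hB k i j) ⟨K i j, ?_, hK i j⟩
  rw [Finset.mem_range, Nat.lt_succ_iff]
  exact (Finset.le_sup (f := fun j => K i j) (Finset.mem_univ j)).trans
    (Finset.le_sup (f := fun i => Finset.univ.sup fun j => K i j) (Finset.mem_univ i))

/-- The Perron–Frobenius theorem: an irreducible nonnegative matrix has a positive eigenvector. -/
theorem exists_pos_eigenvector [Nonempty n] {B : Matrix n n ℝ} (hB : ∀ i j, 0 ≤ B i j)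
    (hirr : ∀ i j, ∃ k, 0 < (B ^ k) i j) :
    ∃ (v : n → ℝ) (l : ℝ), (∀ i, 0 < v i) ∧ 0 ≤ l ∧ B *ᵥ v = l • v := by
  obtain ⟨x, hx, l, hl, hxl, hmax⟩ := exists_max_collatzWielandt hB
  obtain ⟨N, hN⟩ := exists_sum_pow_pos hB hirr
  set P := ∑ k ∈ Finset.range N, B ^ k with hP
  have hcomm : B * P = P * B :=
    (Commute.sum_right _ _ _ fun k _ => (Commute.refl B).pow_right k).eq
  have hx0 : x ≠ 0 := by
    rintro rfl
    simpa using hx.2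
  have hPx := mulVec_pos_of_pos hN hx.1 hx0
  have heig : B *ᵥ x = l • x := by
    by_contra hne
    have hz := mulVec_pos_of_pos hN (z := B *ᵥ x - l • x)
      (fun i => by simpa using hxl i) (sub_ne_zero.2 hne)
    set y := P *ᵥ x with hy
    have hzy : P *ᵥ (B *ᵥ x - l • x) = B *ᵥ y - l • y := by
      rw [Matrix.mulVec_sub, Matrix.mulVec_smul, hy, Matrix.mulVec_mulVec, Matrix.mulVec_mulVec,
        hcomm]
    rw [hzy] at hz
    obtain ⟨i₀, -, hi₀⟩ := Finset.exists_min_image Finset.univ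
      (fun i => (B *ᵥ y - l • y) i / y i) Finset.univ_nonempty
    set e := (B *ᵥ y - l • y) i₀ / y i₀ with he
    have he0 : 0 < e := div_pos (hz i₀) (hPx i₀)
    have hey : ∀ i, (l + e) * y i ≤ (B *ᵥ y) i := by
      intro i
      have h1 := (le_div_iff₀ (hPx i)).1 (hi₀ i (Finset.mem_univ i))
      simp only [Pi.sub_apply, Pi.smul_apply, smul_eq_mul] at h1
      rw [add_mul]
      linarith
    set s := ∑ i, y i with hs
    have hs0 : 0 < s := Finset.sum_pos (fun i _ => hPx i) Finset.univ_nonempty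
    have := hmax (s⁻¹ • y) ⟨fun i => ?_, ?_⟩ (l + e) (by positivity) fun i => ?_
    · linarith
    · exact mul_nonneg (inv_nonneg.2 hs0.le) (hPx i).le
    · simp only [Pi.smul_apply, smul_eq_mul, ← Finset.mul_sum]
      exact inv_mul_cancel₀ hs0.ne'
    · rw [Matrix.mulVec_smul]
      simp only [Pi.smul_apply, smul_eq_mul]
      rw [mul_left_comm]
      exact mul_le_mul_of_nonneg_left (hey i) (inv_nonneg.2 hs0.le)
  refine ⟨x, l, fun i => ?_, hl, heig⟩
  have h1 := hPx i
  rw [hP, Matrix.sum_mulVec, Finset.sum_apply] at h1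
  simp only [mulVec_pow_eq_smul heig, Pi.smul_apply, smul_eq_mul, ← Finset.sum_mul] at h1
  exact (hx.1 i).lt_of_ne' fun h => by simp [h] at h1

theorem pow_apply_le {B : Matrix n n ℝ} (hB : ∀ i j, 0 ≤ B i j) {v : n → ℝ} {l : ℝ}
    (hv : ∀ i, 0 < v i) (h : B *ᵥ v = l • v) (i j : n) (k : ℕ) :
    (B ^ k) i j ≤ v i / v j * l ^ k := by
  have h1 : (B ^ k) i j * v j ≤ ((B ^ k) *ᵥ v) i :=
    Finset.single_le_sum (f := fun j => (B ^ k) i j * v j)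
      (fun j _ => mul_nonneg (pow_apply_nonneg hB k i j) (hv j).le) (Finset.mem_univ j)
  rw [mulVec_pow_eq_smul h, Pi.smul_apply, smul_eq_mul] at h1
  rw [div_mul_eq_mul_div, le_div_iff₀ (hv j)]
  linarith

/-- The diagonal entries of the powers of an irreducible matrix have the growth rate of the
Perron eigenvalue along a subsequence. -/
theorem exists_frequently_le_pow_apply {B : Matrix n n ℝ} (hB : ∀ i j, 0 ≤ B i j)
    (hirr : ∀ i j, ∃ k, 0 < (B ^ k) i j) {v : n → ℝ} {l : ℝ}
    (hv : ∀ i, 0 < v i) (hl : 0 < l) (h : B *ᵥ v = l • v) (i : n) :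
    ∃ c : ℝ, 0 < c ∧ ∃ᶠ k in Filter.atTop, c * l ^ k ≤ (B ^ k) i i := by
  have : Nonempty n := ⟨i⟩
  choose K hK using fun j => hirr j i
  obtain ⟨j₀, -, hj₀⟩ := Finset.exists_min_image Finset.univ
      (fun j => (B ^ K j) j i * v i / (l ^ K j * ∑ j, v j)) Finset.univ_nonempty
  have hs : 0 < ∑ j, v j := Finset.sum_pos (fun i _ => hv i) Finset.univ_nonempty
  refine ⟨_, div_pos (mul_pos (hK j₀) (hv i)) (mul_pos (pow_pos hl (K j₀)) hs),
    Filter.frequently_atTop.2 fun k => ?_⟩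
  obtain ⟨j, hj⟩ : ∃ j, l ^ k * v i * v j / (∑ j, v j) ≤ (B ^ k) i j * v j := by
    by_contra! hcon
    have h1 := Finset.sum_lt_sum_of_nonempty Finset.univ_nonempty fun j _ => hcon j
    have h2 : ∑ j, (B ^ k) i j * v j = l ^ k * v i := by
      have := congrFun (mulVec_pow_eq_smul h k) i
      simpa [Matrix.mulVec, dotProduct] using this
    rw [h2, ← Finset.sum_div, ← Finset.mul_sum, mul_div_cancel_right₀ _ hs.ne'] at h1
    exact h1.false
  refine ⟨k + K j, Nat.le_add_right _ _, ?_⟩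
  have h3 : (B ^ k) i j * (B ^ K j) j i ≤ (B ^ (k + K j)) i i := by
    rw [pow_add, Matrix.mul_apply]
    exact Finset.single_le_sum (f := fun j => (B ^ k) i j * (B ^ K _) j i)
      (fun j' _ => mul_nonneg (pow_apply_nonneg hB k i j') (pow_apply_nonneg hB _ j' i))
      (Finset.mem_univ j)
  have hj' : l ^ k * v i / (∑ j, v j) ≤ (B ^ k) i j := by
    refine le_of_mul_le_mul_right ?_ (hv j)
    rwa [div_mul_eq_mul_div]
  refine le_trans ?_ h3
  refine (mul_le_mul_of_nonneg_right (hj₀ j (Finset.mem_univ j)) (by positivity)).trans ?_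
  refine le_trans (le_of_eq ?_) (mul_le_mul_of_nonneg_right hj' (hK j).le)
  rw [pow_add]
  have := (pow_pos hl (K j)).ne'
  field_simp

end Perron

theorem entropy_eq_log {S : Type*} [Finite S] {L : Language S} {l c C : ℝ} (hl : 0 < l)
    (hc : 0 < c) (hC : 0 < C)
    (hupper : ∀ n, (({w : List S | w ∈ L ∧ w.length = n}.ncard : ℕ) : ℝ) ≤ C * l ^ n)
    (hlower : ∃ᶠ n in Filter.atTop,
      c * l ^ n ≤ (({w : List S | w ∈ L ∧ w.length = n}.ncard : ℕ) : ℝ)) :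
    entropy L = ((Real.log l : ℝ) : EReal) := by
  have hfin : ∀ n, {w : List S | w ∈ L ∧ w.length = n}.Finite := fun n =>
    (List.finite_length_eq S n).subset fun w hw => hw.2
  have hcast : ∀ n, (({w : List S | w ∈ L ∧ w.length = n}.encard : ENat) : ENNReal)
      = ENNReal.ofReal (({w : List S | w ∈ L ∧ w.length = n}.ncard : ℕ) : ℝ) := by
    intro n
    rw [← (hfin n).cast_ncard_eq, ENNReal.ofReal_natCast]
    rfl
  have hlog : ∀ a : ℝ, 0 < a → ∀ n : ℕ, 0 < n →
      ENNReal.log (ENNReal.ofReal (a * l ^ n)) / ((n : ℝ) : EReal)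
        = ((Real.log a / n + Real.log l : ℝ) : EReal) := by
    intro a ha n hn
    rw [ENNReal.log_ofReal_of_pos (by positivity), ← EReal.coe_div,
      Real.log_mul ha.ne' (by positivity), Real.log_pow]
    congr 1
    have : (n : ℝ) ≠ 0 := by positivity
    field_simp
  have hlim : ∀ a : ℝ, Filter.Tendsto (fun n : ℕ => ((Real.log a / n + Real.log l : ℝ) : EReal))
      Filter.atTop (nhds ((Real.log l : ℝ) : EReal)) := by
    intro a
    refine (continuous_coe_real_ereal.tendsto _).comp ?_
    simpa using (tendsto_const_div_atTop_nhds_zero_nat (Real.log a)).add_const (Real.log l)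
  have hmono : ∀ n : ℕ, ∀ a b : ENNReal, a ≤ b →
      ENNReal.log a / ((n : ℝ) : EReal) ≤ ENNReal.log b / ((n : ℝ) : EReal) := fun n a b hab =>
    EReal.div_le_div_right_of_nonneg (by exact_mod_cast n.cast_nonneg) (ENNReal.log_monotone hab)
  unfold entropy
  simp only [hcast]
  apply le_antisymm
  · rw [← (hlim C).limsup_eq]
    refine Filter.limsup_le_limsup ?_
    filter_upwards [Filter.eventually_gt_atTop 0] with n hn
    rw [← hlog C hC n hn]
    exact hmono _ _ _ (ENNReal.ofReal_le_ofReal (hupper n))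
  · refine le_of_forall_lt fun a ha => ?_
    obtain ⟨b, hab, hb⟩ := exists_between ha
    refine hab.trans_le (Filter.le_limsup_of_frequently_le ?_)
    refine (hlower.and_eventually (((hlim c).eventually_const_lt hb).and
      (Filter.eventually_gt_atTop 0))).mono ?_
    rintro n ⟨h1, h2, h3⟩
    rw [← hlog c hc n h3] at h2
    exact h2.le.trans (hmono _ _ _ (ENNReal.ofReal_le_ofReal h1))

section Count

theorem mem_evalFrom_cons {S Q : Type*} {M : NFA S Q} {q q' : Q} {s : S} {w : List S} :
    q' ∈ M.evalFrom {q} (s :: w) ↔ ∃ q₁ ∈ M.step q s, q' ∈ M.evalFrom {q₁} w := by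
  rw [NFA.evalFrom_cons, NFA.stepSet_singleton, NFA.mem_evalFrom_iff_exists]

/-- In a deterministic automaton, the powers of the adjacency matrix count words. -/
theorem adjacencyMatrix_pow_apply {S Q : Type*} [Finite S] [Fintype Q] [DecidableEq Q]
    {M : NFA S Q} (hdet : ∀ q s, (M.step q s).Subsingleton) (n : ℕ) (q q' : Q) :
    (adjacencyMatrix M ^ n) q q' = {w : List S | w.length = n ∧ q' ∈ M.evalFrom {q} w}.ncard := by
  induction n generalizing q with
  | zero =>
    rw [pow_zero, Matrix.one_apply]
    split_ifs with h
    · subst h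
      rw [eq_comm, Set.ncard_eq_one]
      refine ⟨[], Set.ext fun w => ?_⟩
      simp only [Set.mem_ofPred_eq, List.length_eq_zero_iff, Set.mem_singleton_iff,
        and_iff_left_iff_imp]
      rintro rfl
      simp
    · rw [eq_comm, Set.ncard_eq_zero ((List.finite_length_eq S 0).subset fun w hw => hw.1)]
      refine Set.eq_empty_of_forall_notMem ?_
      rintro w ⟨hw, hq⟩
      rw [List.length_eq_zero_iff.1 hw] at hq
      exact h (Set.mem_singleton_iff.1 hq).symm
  | succ n ih =>
    have hfin : ∀ p, Finite {w : List S | w.length = n ∧ q' ∈ M.evalFrom {p} w} := fun p =>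
      ((List.finite_length_eq S n).subset fun w hw => hw.1).to_subtype
    rw [pow_succ', Matrix.mul_apply]
    have hone : ∀ p, adjacencyMatrix M q p = {s : S | p ∈ M.step q s}.ncard := fun p => rfl
    simp only [ih, hone, ← Nat.card_coe_set_eq]
    simp only [← Nat.card_prod]
    rw [← Nat.card_sigma]
    refine Nat.card_congr (Equiv.ofBijective
      (fun p => ⟨p.2.1.1 :: p.2.2.1, by simpa using p.2.2.2.1,
        mem_evalFrom_cons.2 ⟨p.1, p.2.1.2, p.2.2.2.2⟩⟩) ⟨?_, ?_⟩)
    · rintro ⟨p, ⟨s, hs⟩, w, hw⟩ ⟨p', ⟨s', hs'⟩, w', hw'⟩ h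
      simp only [Subtype.mk.injEq, List.cons.injEq] at h
      obtain ⟨rfl, rfl⟩ := h
      obtain rfl := hdet q s hs hs'
      rfl
    · rintro ⟨w, hw, hq⟩
      obtain ⟨s, w, rfl⟩ := List.exists_cons_of_length_eq_add_one hw
      obtain ⟨p, hp, hpw⟩ := mem_evalFrom_cons.1 hq
      exact ⟨⟨p, ⟨s, hp⟩, ⟨w, by simpa using hw, hpw⟩⟩, rfl⟩

end Count

section Words

open FreeGroup

variable {A : Type*}

theorem invLetter_invLetter (x : A × Bool) : invLetter (invLetter x) = x := by
  simp [invLetter]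

theorem ne_invLetter_iff {x y : A × Bool} : y ≠ invLetter x ↔ (x.1 = y.1 → x.2 = y.2) := by
  obtain ⟨a, b⟩ := x
  obtain ⟨c, d⟩ := y
  simp only [invLetter, ne_eq, Prod.mk.injEq, not_and]
  constructor
  · rintro h rfl
    have := h rfl
    cases b <;> cases d <;> simp_all
  · rintro h rfl
    have := h rfl
    cases b <;> cases d <;> simp_all

theorem isReduced_append_iff {u v : List (A × Bool)} :
    IsReduced (u ++ v) ↔
      IsReduced u ∧ IsReduced v ∧ ∀ x ∈ u.getLast?, ∀ y ∈ v.head?, y ≠ invLetter x := by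
  simp only [FreeGroup.IsReduced, List.isChain_append, ne_invLetter_iff]

theorem isReduced_cons_iff {x : A × Bool} {v : List (A × Bool)} :
    IsReduced (x :: v) ↔ IsReduced v ∧ ∀ y ∈ v.head?, y ≠ invLetter x := by
  rw [← List.singleton_append, isReduced_append_iff]
  simp

theorem isReduced_invRev {w : List (A × Bool)} (h : IsReduced w) : IsReduced (invRev w) := by
  classical
  rw [isReduced_iff_reduce_eq] at h ⊢
  rw [reduce_invRev, h]

theorem head?_invRev (w : List (A × Bool)) : (invRev w).head? = w.getLast?.map invLetter := by
  simp only [invRev, List.head?_reverse, List.getLast?_map]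
  rfl

theorem getLast?_invRev (w : List (A × Bool)) : (invRev w).getLast? = w.head?.map invLetter := by
  simp only [invRev, List.getLast?_reverse, List.head?_map]
  rfl

theorem exists_common_prefix (u v : List (A × Bool)) :
    ∃ s p r, u = s ++ p ∧ v = s ++ r ∧ ∀ x ∈ p.head?, x ∉ r.head? := by
  induction u generalizing v with
  | nil => exact ⟨[], [], v, rfl, rfl, by simp⟩
  | cons x u ih =>
    by_cases h : x ∈ v.head?
    · obtain ⟨v, rfl⟩ : ∃ v', v = x :: v' := by
        cases v with
        | nil => simp at h
        | cons y v => exact ⟨v, by simp at h; rw [h]⟩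
      obtain ⟨s, p, r, rfl, rfl, hpr⟩ := ih v
      exact ⟨x :: s, p, r, rfl, rfl, hpr⟩
    · exact ⟨[], x :: u, v, rfl, rfl, by simpa using h⟩

/-- After cancelling the longest common prefix, the quotient of two reduced words is reduced. -/
theorem exists_reduced_quotient {u v : List (A × Bool)} (hu : IsReduced u) (hv : IsReduced v) :
    ∃ s p r, u = s ++ p ∧ v = s ++ r ∧ IsReduced (invRev p ++ r) := by
  obtain ⟨s, p, r, rfl, rfl, hpr⟩ := exists_common_prefix u v
  refine ⟨s, p, r, rfl, rfl, ?_⟩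
  rw [isReduced_append_iff] at hu hv ⊢
  refine ⟨isReduced_invRev hu.2.1, hv.2.1, ?_⟩
  rintro x hx y hy rfl
  rw [getLast?_invRev] at hx
  obtain ⟨z, hz, rfl⟩ := Option.mem_map.1 hx
  rw [invLetter_invLetter] at hy
  exact hpr z hz hy

variable {H : Subgroup (FreeGroup A)}

theorem mk_invRev_append (s p r : List (A × Bool)) :
    mk (invRev p ++ r) = (mk (s ++ p))⁻¹ * mk (s ++ r) := by
  simp only [← mul_mk, ← inv_mk]
  group

theorem invRev_mem_reducedLanguage {w : List (A × Bool)} (h : w ∈ reducedLanguage H) :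
    invRev w ∈ reducedLanguage H :=
  ⟨isReduced_invRev h.1, by rw [← inv_mk]; exact H.inv_mem h.2⟩

theorem mem_zpowers_of_getLast?_ne {f : A × Bool} {a : List (A × Bool)}
    (h0 : ∀ w ∈ reducedLanguage H, f ∈ w.head? ∨ w.getLast? = some (invLetter f) ∨ w = [])
    (ha : a ∈ reducedLanguage H) (hane : a ≠ []) (hal : a.getLast? ≠ some (invLetter f))
    (hmin : ∀ w ∈ reducedLanguage H, w ≠ [] → w.getLast? ≠ some (invLetter f) →
      a.length ≤ w.length)
    {w : List (A × Bool)} (hw : w ∈ reducedLanguage H) (hwl : w.getLast? ≠ some (invLetter f)) :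
    mk w ∈ Subgroup.zpowers (mk a) := by
  obtain ⟨n, hn⟩ : ∃ n, w.length = n := ⟨_, rfl⟩
  induction n using Nat.strong_induction_on generalizing w with
  | _ n ih =>
  by_cases hwne : w = []
  · subst hwne
    exact one_mem _
  have hlen := hmin w hw hwne hwl
  obtain ⟨s, p, r, rfl, rfl, hpr⟩ := exists_reduced_quotient ha.1 hw.1
  have hmem : invRev p ++ r ∈ reducedLanguage H :=
    ⟨hpr, by rw [mk_invRev_append s]; exact H.mul_mem (H.inv_mem ha.2) hw.2⟩
  rcases eq_or_ne p [] with rfl | hp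
  · have hr : mk r ∈ Subgroup.zpowers (mk (s ++ [])) := by
      rcases eq_or_ne r [] with rfl | hr
      · exact one_mem _
      refine ih r.length ?_ (by simpa using hmem) ?_ rfl
      · have : s ≠ [] := by simpa using hane
        have := List.length_pos_iff.2 this
        simp at hn
        omega
      · intro h
        rw [List.getLast?_append, h] at hwl
        simp at hwl
    have hsr : mk (s ++ r) = mk (s ++ []) * mk r := by simp
    rw [hsr]
    exact mul_mem (Subgroup.mem_zpowers _) hr
  · have hr : r ≠ [] := by
      rintro rfl
      exact hp (by simpa using hlen)
    exfalso
    rcases h0 _ hmem with h | h | h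
    · rw [List.head?_append, head?_invRev] at h
      obtain ⟨x, hx⟩ := Option.ne_none_iff_exists'.1 (mt List.getLast?_eq_none_iff.1 hp)
      rw [hx] at h
      rw [List.getLast?_append, hx] at hal
      simp at h hal
      rw [← h, invLetter_invLetter] at hal
      exact hal rfl
    · rw [List.getLast?_append] at h hwl
      obtain ⟨x, hx⟩ := Option.ne_none_iff_exists'.1 (mt List.getLast?_eq_none_iff.1 hr)
      rw [hx] at h hwl
      simp at h hwl
      exact hwl h
    · simp [hr] at h

/-- In a noncyclic subgroup, the absence of elements that do not begin with `f` and do not end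
with `f⁻¹` forces all elements to end with `f⁻¹`. -/
theorem exists_head?_ne_getLast?_ne (hcyc : ¬ IsCyclic H) {f : A × Bool}
    (hred : ∃ w ∈ reducedLanguage H, w ≠ [] ∧ w.getLast? ≠ some (invLetter f)) :
    ∃ w ∈ reducedLanguage H, w ≠ [] ∧ f ∉ w.head? ∧ w.getLast? ≠ some (invLetter f) := by
  by_contra hcon
  have h0 : ∀ w ∈ reducedLanguage H, f ∈ w.head? ∨ w.getLast? = some (invLetter f) ∨ w = [] := by
    intro w hw
    by_contra! h
    exact hcon ⟨w, hw, h.2.2, h.1, h.2.1⟩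
  classical
  have hex : ∃ n, ∃ w ∈ reducedLanguage H, w ≠ [] ∧ w.getLast? ≠ some (invLetter f) ∧
      w.length = n := by
    obtain ⟨w, h1, h2, h3⟩ := hred
    exact ⟨_, w, h1, h2, h3, rfl⟩
  obtain ⟨a, ha, hane, hal, han⟩ := Nat.find_spec hex
  have hmin : ∀ w ∈ reducedLanguage H, w ≠ [] → w.getLast? ≠ some (invLetter f) →
      a.length ≤ w.length := fun w hw h1 h2 => by
    rw [han]
    exact Nat.find_min' hex ⟨w, hw, h1, h2, rfl⟩
  have key := fun {w} => mem_zpowers_of_getLast?_ne (w := w) h0 ha hane hal hmin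
  have hall : ∀ n, ∀ w ∈ reducedLanguage H, w.length = n → mk w ∈ Subgroup.zpowers (mk a) := by
    intro n
    induction n using Nat.strong_induction_on with
    | _ n ih =>
    intro w hw hn
    by_cases hwl : w.getLast? = some (invLetter f)
    swap
    · exact key hw hwl
    by_cases hwh : w.head? = some f
    swap
    · rw [← inv_mem_iff, inv_mk]
      refine key (invRev_mem_reducedLanguage hw) ?_
      rw [getLast?_invRev]
      intro h
      obtain ⟨x, hx, hxf⟩ := Option.map_eq_some_iff.1 h
      apply hwh
      rw [hx, ← invLetter_invLetter x, hxf, invLetter_invLetter]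
    obtain ⟨s, p, r, hs, har, hpr⟩ := exists_reduced_quotient (isReduced_invRev hw.1) ha.1
    have hww : w = invRev p ++ invRev s := by
      rw [← invRev_append, ← hs, invRev_invRev]
    have hmk : mk (invRev p ++ r) = mk w * mk a := by
      rw [mk_invRev_append s, ← hs, ← har, inv_mk, invRev_invRev]
    have hmem : invRev p ++ r ∈ reducedLanguage H :=
      ⟨hpr, by rw [hmk]; exact H.mul_mem hw.2 ha.2⟩
    have hzp : mk (invRev p ++ r) ∈ Subgroup.zpowers (mk a) := by
      rcases eq_or_ne r [] with rfl | hr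
      · refine ih _ ?_ _ hmem rfl
        have := List.length_pos_iff.2 hane
        rw [har] at this
        rw [← hn, hww]
        simp at this ⊢
        exact this
      · refine key hmem ?_
        obtain ⟨x, hx⟩ := Option.ne_none_iff_exists'.1 (mt List.getLast?_eq_none_iff.1 hr)
        rw [har, List.getLast?_append, hx] at hal
        rw [List.getLast?_append, hx]
        simpa using hal
    rw [hmk] at hzp
    exact (Subgroup.mul_mem_cancel_right _ (Subgroup.mem_zpowers _)).1 hzp
  refine hcyc ((Subgroup.isCyclic_iff_exists_zpowers_eq_top H).2 ⟨mk a, le_antisymm ?_ ?_⟩)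
  · rw [Subgroup.zpowers_le]
    exact ha.2
  · intro g hg
    rw [← mk_toWord (x := g)]
    exact hall _ _ ⟨isReduced_toWord, by rwa [mk_toWord]⟩ rfl

/-- Any letter can be joined to any other one through an element of `H`, without cancellation. -/
theorem exists_isReduced_cons_append (hred : ConjugacyReduced H) (hcyc : ¬ IsCyclic H)
    (y f : A × Bool) : ∃ w ∈ reducedLanguage H, IsReduced (y :: w ++ [f]) := by
  by_cases hyf : f = invLetter y
  swap
  · refine ⟨[], ⟨IsReduced.nil, one_mem _⟩, ?_⟩
    rw [isReduced_append_iff]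
    simpa using hyf
  have : ∃ w ∈ reducedLanguage H, w ≠ [] ∧ w.getLast? ≠ some (invLetter f) := by
    obtain ⟨u, v, a, b, ha, hb, hab⟩ := hred
    by_cases h : a = invLetter f
    · refine ⟨_, hb, by simp, ?_⟩
      simp only [List.getLast?_concat, ne_eq, Option.some.injEq]
      rintro rfl
      exact hab h
    · exact ⟨_, ha, by simp, by simpa using h⟩
  obtain ⟨w, hw, hwne, h1, h2⟩ := exists_head?_ne_getLast?_ne hcyc this
  refine ⟨w, hw, ?_⟩
  rw [List.cons_append, isReduced_cons_iff, isReduced_append_iff]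
  refine ⟨⟨hw.1, IsReduced.singleton, ?_⟩, ?_⟩
  · rintro x hx _ hy rfl
    simp at hy
    rw [hy, invLetter_invLetter] at h2
    exact h2 hx
  · rintro x hx rfl
    rw [List.head?_append_of_ne_nil _ hwne] at hx
    rw [hyf] at h1
    exact h1 hx

end Words

section Core

open FreeGroup

variable {A : Type*} (H : Subgroup (FreeGroup A))

theorem endpoint_append (v : SchreierVertex H) (u w : List (A × Bool)) :
    endpoint H v (u ++ w) = endpoint H (endpoint H v u) w := by
  induction v using Quotient.inductionOn' with
  | _ g =>
  simp only [endpoint, Quotient.map'_mk'', ← mul_mk, mul_assoc]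

theorem endpoint_congr (v : SchreierVertex H) {u w : List (A × Bool)} (h : mk u = mk w) :
    endpoint H v u = endpoint H v w := by
  simp only [endpoint, h]

theorem endpoint_of_mk_eq_one (v : SchreierVertex H) {w : List (A × Bool)} (h : mk w = 1) :
    endpoint H v w = v := by
  induction v using Quotient.inductionOn' with
  | _ g => simp only [endpoint, Quotient.map'_mk'', h, mul_one]

theorem endpoint_nil (v : SchreierVertex H) : endpoint H v [] = v :=
  endpoint_of_mk_eq_one H v rfl

theorem endpoint_root_eq_root_iff {w : List (A × Bool)} :
    endpoint H (root H) w = root H ↔ mk w ∈ H := by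
  have : endpoint H (root H) w = Quotient.mk (QuotientGroup.rightRel H) (1 * mk w) := rfl
  rw [this, root, Quotient.eq, QuotientGroup.rightRel_apply, one_mul, one_mul, inv_mem_iff]

theorem exists_closed_of_mem_extendedCoreEdges {e : SchreierVertex H × (A × Bool)}
    (he : e ∈ extendedCoreEdges H) : ∃ w₁ w₂ : List (A × Bool),
      w₁ ++ e.2 :: w₂ ∈ reducedLanguage H ∧ endpoint H (root H) w₁ = e.1 := by
  obtain ⟨w₁, w₂, h1, h2, h3⟩ := he
  exact ⟨w₁, w₂, ⟨h1, (endpoint_root_eq_root_iff H).1 h2⟩, h3⟩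

variable {H} in
theorem mem_extendedCoreEdges {w₁ w₂ : List (A × Bool)} {y : A × Bool}
    (h : w₁ ++ y :: w₂ ∈ reducedLanguage H) :
    (endpoint H (root H) w₁, y) ∈ extendedCoreEdges H :=
  ⟨w₁, w₂, h.1, (endpoint_root_eq_root_iff H).2 h.2, rfl⟩

/-- The path with label `w` from the root stays in the set `V` of vertices. -/
def StaysIn (V : Set (SchreierVertex H)) (w : List (A × Bool)) : Prop :=
  ∀ p, p <+: w → endpoint H (root H) p ∈ V

variable {H} {V : Set (SchreierVertex H)}

theorem prefix_append_cases {S : Type*} {p u w : List S} (h : p <+: u ++ w) :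
    p <+: u ∨ ∃ t, p = u ++ t ∧ t <+: w := by
  rcases List.prefix_or_prefix_of_prefix h (List.prefix_append u w) with h' | ⟨t, rfl⟩
  · exact Or.inl h'
  · exact Or.inr ⟨t, rfl, (List.prefix_append_right_inj u).1 h⟩

theorem StaysIn.append {u w : List (A × Bool)} (hu : StaysIn H V u) (hw : StaysIn H V w)
    (hu' : mk u ∈ H) : StaysIn H V (u ++ w) := by
  intro p hp
  rcases prefix_append_cases hp with h | ⟨t, rfl, ht⟩
  · exact hu p h
  · rw [endpoint_append, (endpoint_root_eq_root_iff H).2 hu']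
    exact hw t ht

theorem StaysIn.invRev {w : List (A × Bool)} (hw : StaysIn H V w) (hw' : mk w ∈ H) :
    StaysIn H V (invRev w) := by
  rintro p ⟨q, hq⟩
  have hwq : w = FreeGroup.invRev q ++ FreeGroup.invRev p := by
    rw [← invRev_append, hq, invRev_invRev]
  have hroot : endpoint H (root H) w = root H := (endpoint_root_eq_root_iff H).2 hw'
  have : endpoint H (root H) p = endpoint H (root H) (FreeGroup.invRev q) := by
    rw [← hroot, ← endpoint_append, hroot]
    refine endpoint_congr H _ ?_
    rw [hwq, List.append_assoc, ← mul_mk, ← mul_mk, ← inv_mk (L := p), inv_mul_cancel, mul_one]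
  rw [this]
  exact hw _ ⟨_, hwq.symm⟩

theorem StaysIn.of_step {u w : List (A × Bool)} (hu : StaysIn H V u) (h : Red.Step u w) :
    StaysIn H V w := by
  rcases h with @⟨L₁, L₂, x, b⟩
  intro p hp
  rcases prefix_append_cases hp with h | ⟨t, rfl, ht⟩
  · exact hu p (h.trans (List.prefix_append _ _))
  · rw [endpoint_congr H _ (w := L₁ ++ (x, b) :: (x, !b) :: t)]
    · refine hu _ ?_
      rw [List.prefix_append_right_inj, List.cons_prefix_cons, List.cons_prefix_cons]
      exact ⟨rfl, rfl, ht⟩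
    · exact (Quot.sound Red.Step.not).symm

theorem StaysIn.of_red {u w : List (A × Bool)} (hu : StaysIn H V u) (h : Red u w) :
    StaysIn H V w := by
  induction h with
  | refl => exact hu
  | tail _ h ih => exact ih.of_step h

/-- The reduced closed paths at the root stay in a finite part of the Schreier graph. -/
theorem exists_finite_staysIn (hfg : H.FG) :
    ∃ V : Set (SchreierVertex H), V.Finite ∧ ∀ w ∈ reducedLanguage H, StaysIn H V w := by
  classical
  obtain ⟨S, hS, hSfin⟩ := (Subgroup.fg_iff H).1 hfg
  let V : Set (SchreierVertex H) :=
    insert (root H) (⋃ s ∈ S, endpoint H (root H) '' {p | p <+: s.toWord})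
  have hpre : ∀ l : List (A × Bool), {p | p <+: l}.Finite := fun l =>
    (l.inits.finite_toSet).subset fun p hp => (List.mem_inits p l).2 hp
  refine ⟨V, (hSfin.biUnion fun s _ => (hpre _).image _).insert _, ?_⟩
  have hall : ∀ g ∈ Subgroup.closure S, StaysIn H V g.toWord := by
    intro g hg
    induction hg using Subgroup.closure_induction with
    | mem s hs =>
      intro p hp
      exact Or.inr (Set.mem_biUnion hs ⟨p, hp, rfl⟩)
    | one =>
      intro p hp
      rw [toWord_one, List.prefix_nil] at hp
      rw [hp, endpoint_nil]
      exact Or.inl rfl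
    | mul g g' hg hg' ih ih' =>
      rw [toWord_mul]
      rw [hS] at hg
      exact (ih.append ih' (by rwa [mk_toWord])).of_red reduce.red
    | inv g hg ih =>
      rw [toWord_inv]
      rw [hS] at hg
      exact ih.invRev (by rwa [mk_toWord])
  intro w hw
  have := hall (mk w) (hS ▸ hw.2)
  rwa [toWord_mk, hw.1.reduce_eq] at this

theorem finite_dHatState [Finite A] (hfg : H.FG) : Finite (DHatState H) := by
  obtain ⟨V, hV, hstay⟩ := exists_finite_staysIn hfg
  refine ((hV.prod (Set.finite_univ (α := A × Bool))).subset ?_).to_subtype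
  rintro ⟨v, x⟩ ⟨e, he, hv, rfl⟩
  obtain ⟨w₁, w₂, hw, hw₁⟩ := exists_closed_of_mem_extendedCoreEdges H he
  refine ⟨?_, Set.mem_univ _⟩
  dsimp only at hv ⊢
  rw [← hv, ← hw₁, ← endpoint_append]
  exact hstay _ hw _ ⟨w₂, by simp⟩

theorem dHat_step_subsingleton (q : DHatState H) (y : A × Bool) :
    ((DHat H).step q y).Subsingleton := by
  rintro p ⟨-, -, hp⟩ p' ⟨-, -, hp'⟩
  exact Subtype.ext (hp.trans hp'.symm)

theorem of_mem_evalFrom_dHat {q q' : DHatState H} {w : List (A × Bool)}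
    (h : q' ∈ (DHat H).evalFrom {q} w) :
    IsReduced (q.1.2 :: w) ∧ q'.1.1 = endpoint H q.1.1 w ∧
      (q.1.2 :: w).getLast? = some q'.1.2 := by
  induction w generalizing q with
  | nil =>
    obtain rfl : q' = q := h
    exact ⟨IsReduced.singleton, (endpoint_nil H _).symm, rfl⟩
  | cons y w ih =>
    obtain ⟨p, ⟨h1, -, h3⟩, hp⟩ := mem_evalFrom_cons.1 h
    obtain ⟨h4, h5, h6⟩ := ih hp
    rw [h3] at h4 h5 h6
    refine ⟨?_, ?_, ?_⟩
    · rw [isReduced_cons_iff]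
      exact ⟨h4, by simpa using h1⟩
    · exact h5.trans (endpoint_append H q.1.1 [y] w).symm
    · rw [List.getLast?_cons_cons]
      exact h6

/-- The automaton reads every piece of a reduced closed path at the root. -/
theorem exists_mem_evalFrom_dHat {p r t : List (A × Bool)} (h : p ++ r ++ t ∈ reducedLanguage H)
    {q : DHatState H} (hq : q.1.1 = endpoint H (root H) p) (hr : IsReduced (q.1.2 :: r)) :
    ∃ q', q' ∈ (DHat H).evalFrom {q} r := by
  induction r generalizing p q with
  | nil => exact ⟨q, rfl⟩
  | cons y r ih =>
    have hcore : (q.1.1, y) ∈ extendedCoreEdges H := by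
      rw [hq]
      refine mem_extendedCoreEdges (w₂ := r ++ t) ?_
      simpa using h
    rw [isReduced_cons_iff] at hr
    let q₁ : DHatState H := ⟨(endpoint H q.1.1 [y], y), _, hcore, rfl, rfl⟩
    obtain ⟨q', hq'⟩ := ih (p := p ++ [y]) (q := q₁) (by simpa using h)
      (by rw [endpoint_append, ← hq]) hr.1
    exact ⟨q', mem_evalFrom_cons.2 ⟨q₁, ⟨by simpa using hr.2, hcore, rfl⟩, hq'⟩⟩

theorem mem_evalFrom_append {S Q : Type*} {M : NFA S Q} {q q₁ q₂ : Q} {u w : List S}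
    (h : q₁ ∈ M.evalFrom {q} u) (h' : q₂ ∈ M.evalFrom {q₁} w) : q₂ ∈ M.evalFrom {q} (u ++ w) := by
  rw [NFA.evalFrom_append, NFA.mem_evalFrom_iff_exists]
  exact ⟨q₁, h, h'⟩

theorem isReduced_cons_of_append {u w : List (A × Bool)} {x : A × Bool}
    (h : IsReduced (u ++ w)) (hx : u.getLast? = some x) : IsReduced (x :: w) := by
  rw [isReduced_append_iff] at h
  rw [isReduced_cons_iff]
  exact ⟨h.2.1, h.2.2 x hx⟩

theorem exists_closed_of_dHatState (q : DHatState H) :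
    ∃ w₁ w₂ : List (A × Bool), w₁ ++ q.1.2 :: w₂ ∈ reducedLanguage H ∧
      endpoint H (root H) (w₁ ++ [q.1.2]) = q.1.1 := by
  obtain ⟨⟨v, x⟩, e, he, hv, hx⟩ := q
  dsimp only at hv hx ⊢
  subst hx
  obtain ⟨w₁, w₂, hw, hw₁⟩ := exists_closed_of_mem_extendedCoreEdges H he
  exact ⟨w₁, w₂, hw, by rw [endpoint_append, hw₁, hv]⟩

/-- The automaton is strongly connected. -/
theorem exists_mem_evalFrom_dHat_of_conjugacyReduced (hred : ConjugacyReduced H)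
    (hcyc : ¬ IsCyclic H) (q q' : DHatState H) : ∃ w, q' ∈ (DHat H).evalFrom {q} w := by
  obtain ⟨w₁, w₂, hw, hwq⟩ := exists_closed_of_dHatState q
  obtain ⟨u₁, u₂, hu, huq⟩ := exists_closed_of_dHatState q'
  obtain ⟨q₁, hq₁⟩ : ∃ q₁, q₁ ∈ (DHat H).evalFrom {q} w₂ := by
    refine exists_mem_evalFrom_dHat (p := w₁ ++ [q.1.2]) (t := []) (by simpa using hw) hwq.symm ?_
    exact ((isReduced_append_iff).1 hw.1).2.1
  obtain ⟨-, hq₁v, -⟩ := of_mem_evalFrom_dHat hq₁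
  rw [← hwq, ← endpoint_append, List.append_assoc, List.singleton_append,
    (endpoint_root_eq_root_iff H).2 hw.2] at hq₁v
  obtain ⟨f, s, hfs⟩ : ∃ f s, u₁ ++ [q'.1.2] = f :: s := by
    cases u₁ with
    | nil => exact ⟨_, _, rfl⟩
    | cons f u₁ => exact ⟨_, _, rfl⟩
  obtain ⟨w, hwH, hwr⟩ := exists_isReduced_cons_append hred hcyc q₁.1.2 f
  obtain ⟨q₂, hq₂⟩ : ∃ q₂, q₂ ∈ (DHat H).evalFrom {q₁} w := by
    refine exists_mem_evalFrom_dHat (p := []) (t := []) (by simpa using hwH) ?_ ?_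
    · rw [hq₁v, endpoint_nil]
    · exact (isReduced_append_iff.1 hwr).1
  obtain ⟨-, hq₂v, hq₂l⟩ := of_mem_evalFrom_dHat hq₂
  rw [hq₁v, (endpoint_root_eq_root_iff H).2 hwH.2] at hq₂v
  have hu' : (f :: s) ++ u₂ ∈ reducedLanguage H := by
    rw [← hfs]
    simpa using hu
  obtain ⟨q₃, hq₃⟩ : ∃ q₃, q₃ ∈ (DHat H).evalFrom {q₂} (u₁ ++ [q'.1.2]) := by
    rw [hfs]
    refine exists_mem_evalFrom_dHat (p := []) (t := u₂) hu' ?_ ?_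
    · rw [hq₂v, endpoint_nil]
    · have h1 := isReduced_cons_of_append hwr hq₂l
      rw [isReduced_cons_iff] at h1 ⊢
      exact ⟨(isReduced_append_iff.1 hu'.1).1, h1.2⟩
  obtain ⟨-, hq₃v, hq₃l⟩ := of_mem_evalFrom_dHat hq₃
  obtain rfl : q' = q₃ := by
    refine Subtype.ext (Prod.ext ?_ ?_)
    · rw [hq₃v, hq₂v, huq]
    · rw [← List.cons_append, List.getLast?_concat] at hq₃l
      exact Option.some.inj hq₃l
  exact ⟨_, mem_evalFrom_append (mem_evalFrom_append hq₁ hq₂) hq₃⟩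

theorem exists_root_state {u : List (A × Bool)} {x : A × Bool}
    (h : u ++ [x] ∈ reducedLanguage H) : ∃ q : DHatState H, q.1 = (root H, x) := by
  refine ⟨⟨(root H, x), _, mem_extendedCoreEdges h, ?_, rfl⟩, rfl⟩
  dsimp only
  rw [← endpoint_append, (endpoint_root_eq_root_iff H).2 h.2]

theorem mem_reducedLanguage_of_mem_evalFrom {q q' : DHatState H} (hq : q.1.1 = root H)
    (hq' : q'.1.1 = root H) {w : List (A × Bool)} (h : q' ∈ (DHat H).evalFrom {q} w) :
    w ∈ reducedLanguage H := by
  obtain ⟨h1, h2, -⟩ := of_mem_evalFrom_dHat h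
  rw [hq, hq'] at h2
  exact ⟨(isReduced_cons_iff.1 h1).1, (endpoint_root_eq_root_iff H).1 h2.symm⟩

theorem exists_mem_evalFrom_of_mem_reducedLanguage (hred : ConjugacyReduced H)
    {w : List (A × Bool)} (hw : w ∈ reducedLanguage H) :
    ∃ q q' : DHatState H, q' ∈ (DHat H).evalFrom {q} w := by
  obtain ⟨q, hq, hqw⟩ : ∃ q : DHatState H, q.1.1 = root H ∧ IsReduced (q.1.2 :: w) := by
    obtain ⟨u, v, x, y, hx, hy, hxy⟩ := hred
    obtain ⟨q, hq⟩ := exists_root_state hx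
    obtain ⟨p, hp⟩ := exists_root_state hy
    by_cases h : IsReduced (x :: w)
    · exact ⟨q, by rw [hq], by rwa [hq]⟩
    · refine ⟨p, by rw [hp], ?_⟩
      rw [hp]
      rw [isReduced_cons_iff] at h ⊢
      refine ⟨hw.1, ?_⟩
      rintro z hz rfl
      refine h ⟨hw.1, fun z' hz' hzz => hxy ?_⟩
      obtain rfl : invLetter y = z' := Option.some.inj (hz.symm.trans hz')
      rw [← invLetter_invLetter x, ← hzz, invLetter_invLetter]
  obtain ⟨q', hq'⟩ := exists_mem_evalFrom_dHat (p := []) (t := []) (by simpa using hw)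
    (by rw [hq, endpoint_nil]) hqw
  exact ⟨q, q', hq'⟩

theorem ncard_le_sum_pow_apply [Finite A] [Fintype (DHatState H)] [DecidableEq (DHatState H)]
    (hred : ConjugacyReduced H) (n : ℕ) :
    {w | w ∈ reducedLanguage H ∧ w.length = n}.ncard ≤
      ∑ q, ∑ q', (adjacencyMatrix (DHat H) ^ n) q q' := by
  simp only [adjacencyMatrix_pow_apply dHat_step_subsingleton]
  rw [← Fintype.sum_prod_type' (f := fun q q' =>
    {w : List (A × Bool) | w.length = n ∧ q' ∈ (DHat H).evalFrom {q} w}.ncard)]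
  refine le_trans (Set.ncard_le_ncard ?_ ?_) (Finset.univ.set_ncard_biUnion_le
    fun p : DHatState H × DHatState H =>
      {w : List (A × Bool) | w.length = n ∧ p.2 ∈ (DHat H).evalFrom {p.1} w})
  · rintro w ⟨hw, hn⟩
    obtain ⟨q, q', h⟩ := exists_mem_evalFrom_of_mem_reducedLanguage hred hw
    exact Set.mem_biUnion (Finset.mem_univ (q, q')) ⟨hn, h⟩
  · refine Set.Finite.biUnion (Finset.finite_toSet _) fun p _ => ?_
    exact (List.finite_length_eq _ n).subset fun w hw => hw.1

theorem pow_apply_le_ncard [Finite A] [Fintype (DHatState H)] [DecidableEq (DHatState H)]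
    {q : DHatState H} (hq : q.1.1 = root H) (n : ℕ) :
    (adjacencyMatrix (DHat H) ^ n) q q ≤ {w | w ∈ reducedLanguage H ∧ w.length = n}.ncard := by
  rw [adjacencyMatrix_pow_apply dHat_step_subsingleton]
  refine Set.ncard_le_ncard ?_ ((List.finite_length_eq _ n).subset fun w hw => hw.2)
  rintro w ⟨hn, hw⟩
  exact ⟨mem_reducedLanguage_of_mem_evalFrom hq hq hw, hn⟩

end Core

end CogrowthEntropy

open CogrowthEntropy in
theorem mainTheorem3 {A : Type*} [Finite A] (H : Subgroup (FreeGroup A))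
    (hfg : H.FG) (hred : CogrowthEntropy.ConjugacyReduced H) (hcyc : ¬ IsCyclic H) :
    ∃ (_ : Fintype (CogrowthEntropy.DHatState H)) (l : ℝ),
      0 < l ∧
      Module.End.HasEigenvalue (Matrix.mulVecLin
        ((CogrowthEntropy.adjacencyMatrix (CogrowthEntropy.DHat H)).map (fun k : ℕ => (k : ℝ)))) l ∧
      (∀ μ : ℂ, Module.End.HasEigenvalue (Matrix.mulVecLin
        ((CogrowthEntropy.adjacencyMatrix (CogrowthEntropy.DHat H)).map (fun k : ℕ => (k : ℂ)))) μ →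
          ‖μ‖ ≤ l) ∧
      CogrowthEntropy.entropy (CogrowthEntropy.reducedLanguage H) = ((Real.log l : ℝ) : EReal) := by
  classical
  have : Finite (DHatState H) := finite_dHatState hfg
  have hfin : Fintype (DHatState H) := Fintype.ofFinite _
  obtain ⟨u, v, x, y, hx, hy, hxy⟩ := id hred
  obtain ⟨q, hq⟩ := exists_root_state hx
  obtain ⟨p, hp⟩ := exists_root_state hy
  have hqp : q ≠ p := by
    rintro rfl
    exact hxy (congrArg Prod.snd (hq.symm.trans hp))
  have : Nonempty (DHatState H) := ⟨q⟩
  set M := adjacencyMatrix (DHat H) with hM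
  set B : Matrix (DHatState H) (DHatState H) ℝ := M.map (fun k : ℕ => (k : ℝ))
  have hpow : ∀ k i j, (B ^ k) i j = (((M ^ k) i j : ℕ) : ℝ) := by
    intro k i j
    have : B = M.map (Nat.castRingHom ℝ) := rfl
    rw [this, ← Matrix.map_pow]
    rfl
  have hB : ∀ i j, 0 ≤ B i j := fun i j => Nat.cast_nonneg _
  have hirr : ∀ i j, ∃ k, 0 < (B ^ k) i j := by
    intro i j
    obtain ⟨w, hw⟩ := exists_mem_evalFrom_dHat_of_conjugacyReduced hred hcyc i j
    refine ⟨w.length, ?_⟩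
    rw [hpow, Nat.cast_pos, hM, adjacencyMatrix_pow_apply dHat_step_subsingleton,
      Set.ncard_pos ((List.finite_length_eq _ w.length).subset fun w hw => hw.1)]
    exact ⟨w, rfl, hw⟩
  obtain ⟨v, l, hv, hl0, hvl⟩ := exists_pos_eigenvector hB hirr
  have hl : 0 < l := by
    refine hl0.lt_of_ne' ?_
    rintro rfl
    obtain ⟨k, hk⟩ := hirr q p
    have h1 := pow_apply_le hB hv hvl q p k
    rcases eq_or_ne k 0 with rfl | hk0
    · rw [pow_zero, Matrix.one_apply_ne hqp] at hk
      exact hk.false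
    · rw [zero_pow hk0, mul_zero] at h1
      exact absurd hk h1.not_gt
  refine ⟨hfin, l, hl, ?_, ?_, ?_⟩
  · refine Module.End.hasEigenvalue_of_hasEigenvector (x := v) ⟨?_, ?_⟩
    · rw [Module.End.mem_eigenspace_iff]
      exact hvl
    · rintro rfl
      exact (hv q).false
  · intro μ hμ
    obtain ⟨w, hw, hw0⟩ := hμ.exists_hasEigenvector
    rw [Module.End.mem_eigenspace_iff] at hw
    refine norm_le_of_pos_eigenvector hB hv hvl hw0 ?_
    rw [← hw, Matrix.mulVecLin_apply]
    congr 1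
  · obtain ⟨c, hc, hfreq⟩ := exists_frequently_le_pow_apply hB hirr hv hl hvl q
    refine entropy_eq_log hl hc (C := ∑ i, ∑ j, v i / v j) ?_ (fun n => ?_) (hfreq.mono fun n hn => ?_)
    · exact Finset.sum_pos (fun i _ => Finset.sum_pos (fun j _ => div_pos (hv i) (hv j))
        Finset.univ_nonempty) Finset.univ_nonempty
    · refine (Nat.cast_le.2 (ncard_le_sum_pow_apply hred n)).trans ?_
      simp only [Nat.cast_sum, Finset.sum_mul]
      refine Finset.sum_le_sum fun i _ => Finset.sum_le_sum fun j _ => ?_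
      rw [← hM, ← hpow]
      exact pow_apply_le hB hv hvl i j n
    · rw [hpow] at hn
      exact hn.trans (Nat.cast_le.2 (pow_apply_le_ncard (by rw [hq]) n))
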